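/- For complex numbers $a,q$ with $|q|<1$ put $(a;q)_\infty=\prod_{n=0}^{\infty}(1-aq^n)$, and let $f(-q)=(q;q)_\infty$ and $\Phi(-q)=(-q;q)_\infty$. Then for every complex number $q$ with $|q|<1$, $$\frac{\Phi(-q)-f(-q)}{\Phi(-q)+f(-q)}=\cfrac{q}{1-q+\cfrac{q^3}{1-q^3+\cfrac{q^5}{1-q^5+\cfrac{q^7}{1-q^7+\cdots}}}}$$ in the following sense. Let $A_n/B_n$ be the $n$-th convergent of the continued fraction, where $A_{-1}=1$, $A_0=0$, $B_{-1}=0$, $B_0=1$ and $A_n=(1-q^{2n-1})A_{n-1}+q^{2n-1}A_{n-2}$, $B_n=(1-q^{2n-1})B_{n-1}+q^{2n-1}B_{n-2}$ for $n\ge 1$. Then $B_n\neq 0$ for all sufficiently large $n$. If $\Phi(-q)+f(-q)\neq 0$, then $A_n/B_n$ converges to the left-hand side; if $\Phi(-q)+f(-q)=0$, then $|A_n/B_n|\to\infty$, i.e. both sides equal $\infty$. -/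

import Mathlib

/-!
A continued fraction with partial numerators `aₙ` and partial denominators `1 - aₙ` is Euler's: its
denominators are the partial sums of `∑ₖ ∏_{j<k} (-aⱼ)` and its numerators are one minus these. For
`aₙ = q^(2n+1)` the series is `∑_{k ≥ 0} (-1)ᵏ q^(k²)`, which Gauss's identity
`∑_{k ∈ ℤ} (-1)ᵏ q^(k²) = (q;q)_∞ / (-q;q)_∞` evaluates.

Gauss's identity is the limit of an exact identity between the `n`-th partial theta sum and the
`q`-binomial series of `(-1;q)_s / (q;q)_s`, truncated after `s = n` and evaluated at `-q^(n+1)`;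
the functional equation of the `q`-binomial series, truncated, is the induction step.
If the theta series sums to `0`, its partial sums still avoid `0` from some index on, because its
terms decay so fast that each one dominates the sum of all later ones.
-/

open Filter Topology

noncomputable section

/-- The finite `q`-Pochhammer symbol `(a;q)_k = ∏_{n=0}^{k-1} (1 - a qⁿ)`. -/
def qPoch (a q : ℂ) (k : ℕ) : ℂ := ∏ n ∈ Finset.range k, (1 - a * q ^ n)

/-- The infinite `q`-Pochhammer symbol `(a;q)_∞ = ∏_{n=0}^{∞} (1 - a qⁿ)`. -/
def qPochInf (a q : ℂ) : ℂ := ∏' n : ℕ, (1 - a * q ^ n)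

/-- For `|q| < 1` the infinite product converges, and it is the limit of `(a;q)_k`. -/
theorem qPoch_tendsto_qPochInf (a q : ℂ) (hq : ‖q‖ < 1) :
    Tendsto (qPoch a q) atTop (𝓝 (qPochInf a q)) := by
  have hs : Summable fun n : ℕ => ‖-(a * q ^ n)‖ := by
    simp only [norm_neg, norm_mul, norm_pow]
    exact (summable_geometric_of_lt_one (norm_nonneg q) hq).mul_left _
  have hm : Multipliable fun n : ℕ => (1 - a * q ^ n) := by
    simpa [sub_eq_add_neg] using multipliable_one_add_of_summable hs
  exact hm.hasProd.tendsto_prod_nat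

/-- Ramanujan's `f`, normalised so that `f(-q) = (q;q)_∞`. -/
def ramanujanF (x : ℂ) : ℂ := qPochInf (-x) (-x)

/-- The function `Φ`, normalised so that `Φ(-q) = (-q;q)_∞`. -/
def ramanujanPhi (x : ℂ) : ℂ := qPochInf x (-x)

theorem ramanujanF_neg (q : ℂ) : ramanujanF (-q) = qPochInf q q := by
  simp [ramanujanF]

theorem ramanujanPhi_neg (q : ℂ) : ramanujanPhi (-q) = qPochInf (-q) q := by
  simp [ramanujanPhi]

/-- The infinite continued fraction
`q/(1-q) + q³/(1-q³) + q⁵/(1-q⁵) + ⋯` (with head term `0`): the pair with index `n` has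
partial numerator `q^(2n+1)` and partial denominator `1 - q^(2n+1)`. -/
def oddPowerCF (q : ℂ) : GenContFract ℂ where
  h := 0
  s := Stream'.Seq.ofStream fun n : ℕ =>
    (⟨q ^ (2 * n + 1), 1 - q ^ (2 * n + 1)⟩ : GenContFract.Pair ℂ)

end

section Normed

theorem eventually_ne_of_dist_succ_le_mul {X : Type*} [MetricSpace X] {u : ℕ → X} {x : X} {r : ℝ}
    (hr : r < 1 / 2) (hu : Tendsto u atTop (𝓝 x))
    (hne : ∀ᶠ n in atTop, u n ≠ u (n + 1))
    (hdist : ∀ᶠ n in atTop, dist (u (n + 1)) (u (n + 2)) ≤ r * dist (u n) (u (n + 1))) :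
    ∀ᶠ n in atTop, u n ≠ x := by
  filter_upwards [hne, eventually_forall_ge_atTop.mpr hdist] with n hn hdist_ge hx
  have hr₀ : 0 ≤ r :=
    nonneg_of_mul_nonneg_left (dist_nonneg.trans (hdist_ge n le_rfl)) (dist_pos.mpr hn)
  have hgeom (m : ℕ) : dist (u (n + m)) (u (n + (m + 1))) ≤ dist (u n) (u (n + 1)) * r ^ m := by
    induction m with
    | zero => simp
    | succ m ih =>
      calc dist (u (n + (m + 1))) (u (n + (m + 2)))
          ≤ r * dist (u (n + m)) (u (n + (m + 1))) := hdist_ge (n + m) (n.le_add_right m)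
        _ ≤ r * (dist (u n) (u (n + 1)) * r ^ m) := by gcongr
        _ = dist (u n) (u (n + 1)) * r ^ (m + 1) := by ring
  have htail : dist (u (n + 1)) x ≤ dist (u n) (u (n + 1)) * r ^ 1 / (1 - r) :=
    dist_le_of_le_geometric_of_tendsto r _ (by linarith) hgeom
      ((tendsto_add_atTop_iff_nat n).mpr hu |>.congr fun m => by rw [add_comm]) 1
  rw [← hx, dist_comm, pow_one, le_div_iff₀ (by linarith)] at htail
  nlinarith [dist_pos.mpr hn]

theorem tendsto_sum_range_succ_mul_pow {ι R : Type*} [NormedRing R] {l : Filter ι} {c : ℕ → R}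
    {C : ℝ} (hc : ∀ s, ‖c s‖ ≤ C) {z : ι → R} (hz : Tendsto z l (𝓝 0)) (N : ι → ℕ) :
    Tendsto (fun i => ∑ s ∈ Finset.range (N i + 1), c s * z i ^ s) l (𝓝 (c 0)) := by
  have hC : 0 ≤ C := (norm_nonneg _).trans (hc 0)
  have hz_norm : Tendsto (fun i => ‖z i‖) l (𝓝 0) := tendsto_zero_iff_norm_tendsto_zero.mp hz
  have hbound : Tendsto (fun i => C * ‖z i‖ * (1 - ‖z i‖)⁻¹) l (𝓝 0) := by
    simpa using (hz_norm.const_mul C).mul ((hz_norm.const_sub 1).inv₀ (by simp))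
  rw [tendsto_iff_norm_sub_tendsto_zero]
  refine squeeze_zero' (.of_forall fun _ => norm_nonneg _) ?_ hbound
  filter_upwards [hz_norm.eventually_lt_const zero_lt_one] with i hi
  rw [Finset.sum_range_succ', pow_zero, mul_one, add_sub_cancel_right]
  calc ‖∑ s ∈ Finset.range (N i), c (s + 1) * z i ^ (s + 1)‖
      ≤ ∑ s ∈ Finset.range (N i), C * ‖z i‖ * ‖z i‖ ^ s := norm_sum_le_of_le _ fun s _ => by
        rw [mul_assoc, ← pow_succ']
        exact norm_mul_le_of_le (hc _) (norm_pow_le' _ s.succ_pos)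
    _ = C * ‖z i‖ * ∑ s ∈ Finset.range (N i), ‖z i‖ ^ s := (Finset.mul_sum ..).symm
    _ ≤ C * ‖z i‖ * (1 - ‖z i‖)⁻¹ := by
        gcongr
        rw [← tsum_geometric_of_lt_one (norm_nonneg _) hi]
        exact (summable_geometric_of_lt_one (norm_nonneg _) hi).sum_le_tsum _
          fun _ _ => by positivity

theorem mul_pow_ne_one {K : Type*} [NormedDivisionRing K] {a q : K} (ha : ‖a‖ < 1) (hq : ‖q‖ ≤ 1)
    (n : ℕ) : a * q ^ n ≠ 1 := by
  refine ne_of_apply_ne norm (ne_of_lt ?_)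
  rw [norm_mul, norm_pow, norm_one]
  exact mul_lt_one_of_nonneg_of_lt_one_left (norm_nonneg a) ha (pow_le_one₀ (norm_nonneg q) hq)

theorem pow_succ_ne_one {K : Type*} [NormedDivisionRing K] {q : K} (hq : ‖q‖ < 1) (n : ℕ) :
    q ^ (n + 1) ≠ 1 :=
  pow_succ' q n ▸ mul_pow_ne_one hq hq.le n

end Normed

section EulerContinuedFraction

/-- Euler's continued fraction `a₀/(1 - a₀) + a₁/(1 - a₁) + ⋯`, whose denominators are the partial
sums of a series. The head term is `0`. -/
def eulerCF {K : Type*} [Ring K] (a : ℕ → K) : GenContFract K where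
  h := 0
  s := Stream'.Seq.ofStream fun n => ⟨a n, 1 - a n⟩

/-- The partial sum `∑_{k=0}^n ∏_{j<k} (-aⱼ)` of the series attached to `eulerCF a`; the upper end
`n` is included. -/
def eulerSum {R : Type*} [CommRing R] (a : ℕ → R) (n : ℕ) : R :=
  ∑ k ∈ Finset.range (n + 1), ∏ j ∈ Finset.range k, -a j

theorem eulerSum_zero {R : Type*} [CommRing R] (a : ℕ → R) : eulerSum a 0 = 1 := by
  simp [eulerSum]

theorem eulerSum_succ {R : Type*} [CommRing R] (a : ℕ → R) (n : ℕ) :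
    eulerSum a (n + 1) = eulerSum a n + ∏ j ∈ Finset.range (n + 1), -a j :=
  Finset.sum_range_succ _ _

section Field

variable {K : Type*} [Field K] (a : ℕ → K)

theorem eulerCF_s_get? (n : ℕ) : (eulerCF a).s.get? n = some ⟨a n, 1 - a n⟩ := rfl

theorem eulerCF_dens (n : ℕ) : (eulerCF a).dens n = eulerSum a n := by
  induction n using Nat.twoStepInduction with
  | zero => rw [GenContFract.zeroth_den_eq_one, eulerSum_zero]
  | one =>
    rw [GenContFract.first_den_eq (eulerCF_s_get? a 0), eulerSum_succ, eulerSum_zero,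
      Finset.prod_range_one, sub_eq_add_neg]
  | more n ih₀ ih₁ =>
    rw [GenContFract.dens_recurrence (eulerCF_s_get? a (n + 1)) ih₀ ih₁,
      eulerSum_succ a (n + 1), eulerSum_succ a n, Finset.prod_range_succ _ (n + 1)]
    ring

theorem eulerCF_nums (n : ℕ) : (eulerCF a).nums n = 1 - eulerSum a n := by
  induction n using Nat.twoStepInduction with
  | zero => rw [GenContFract.zeroth_num_eq_h, eulerSum_zero, sub_self, eulerCF]
  | one =>
    rw [GenContFract.first_num_eq (eulerCF_s_get? a 0), eulerSum_succ, eulerSum_zero,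
      Finset.prod_range_one, eulerCF]
    ring
  | more n ih₀ ih₁ =>
    rw [GenContFract.nums_recurrence (eulerCF_s_get? a (n + 1)) ih₀ ih₁,
      eulerSum_succ a (n + 1), eulerSum_succ a n, Finset.prod_range_succ _ (n + 1)]
    ring

theorem eulerCF_convs (n : ℕ) : (eulerCF a).convs n = (1 - eulerSum a n) / eulerSum a n := by
  rw [GenContFract.conv_eq_num_div_den, eulerCF_nums, eulerCF_dens]

end Field

section NormedField

variable {K : Type*} [NormedField K] {a : ℕ → K}

theorem dist_eulerSum_succ (n : ℕ) :
    dist (eulerSum a n) (eulerSum a (n + 1)) = ∏ j ∈ Finset.range (n + 1), ‖a j‖ := by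
  rw [eulerSum_succ, dist_self_add_right, norm_prod]
  simp only [norm_neg]

theorem eventually_eulerSum_ne {x : K} (ha : ∀ n, a n ≠ 0) (ha_lim : Tendsto a atTop (𝓝 0))
    (hx : Tendsto (eulerSum a) atTop (𝓝 x)) (y : K) : ∀ᶠ n in atTop, eulerSum a n ≠ y := by
  rcases ne_or_eq x y with hxy | rfl
  · exact hx.eventually_ne hxy
  have hne (n : ℕ) : eulerSum a n ≠ eulerSum a (n + 1) := by
    rw [← dist_pos, dist_eulerSum_succ]
    exact Finset.prod_pos fun j _ => norm_pos_iff.mpr (ha j)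
  have hsmall : ∀ᶠ n in atTop, ‖a (n + 1)‖ ≤ 1 / 3 :=
    ((tendsto_add_atTop_iff_nat 1).mpr ha_lim).norm.eventually_le_const (by simp)
  refine eventually_ne_of_dist_succ_le_mul (r := 1 / 3) (by norm_num) hx
    (.of_forall hne) ?_
  filter_upwards [hsmall] with n hn
  rw [dist_eulerSum_succ, dist_eulerSum_succ, Finset.prod_range_succ _ (n + 1), mul_comm]
  gcongr

theorem tendsto_eulerCF_convs {x : K} (hx₀ : x ≠ 0) (hx : Tendsto (eulerSum a) atTop (𝓝 x)) :
    Tendsto (eulerCF a).convs atTop (𝓝 ((1 - x) / x)) :=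
  ((hx.const_sub 1).div hx hx₀).congr fun n => (eulerCF_convs a n).symm

theorem tendsto_eulerCF_convs_cobounded (hne : ∀ᶠ n in atTop, eulerSum a n ≠ 0)
    (h₀ : Tendsto (eulerSum a) atTop (𝓝 0)) :
    Tendsto (eulerCF a).convs atTop (Bornology.cobounded K) := by
  have hinv : Tendsto (fun n => (eulerSum a n)⁻¹) atTop (Bornology.cobounded K) :=
    tendsto_inv₀_nhdsNE_zero.comp (tendsto_nhdsWithin_iff.mpr ⟨h₀, hne⟩)
  refine ((tendsto_sub_const_cobounded (1 : K)).comp hinv).congr' ?_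
  filter_upwards [hne] with n hn
  rw [Function.comp_apply, eulerCF_convs, sub_div, div_self hn, one_div]

end NormedField

end EulerContinuedFraction

section QPochhammer

variable {a q : ℂ}

theorem qPoch_zero (a q : ℂ) : qPoch a q 0 = 1 := Finset.prod_range_zero _

theorem qPoch_succ (a q : ℂ) (n : ℕ) : qPoch a q (n + 1) = qPoch a q n * (1 - a * q ^ n) :=
  Finset.prod_range_succ _ _

theorem qPoch_succ' (a q : ℂ) (n : ℕ) : qPoch a q (n + 1) = (1 - a) * qPoch (a * q) q n := by
  simp only [qPoch, Finset.prod_range_succ', pow_succ', pow_zero, mul_one, mul_assoc, mul_comm]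

theorem qPoch_self_succ (q : ℂ) (n : ℕ) :
    qPoch q q (n + 1) = qPoch q q n * (1 - q ^ (n + 1)) := by
  rw [qPoch_succ, pow_succ']

theorem qPoch_ne_zero (ha : ∀ n : ℕ, a * q ^ n ≠ 1) (n : ℕ) : qPoch a q n ≠ 0 :=
  Finset.prod_ne_zero_iff.mpr fun k _ => sub_ne_zero.mpr (ha k).symm

theorem qPoch_self_ne_zero (hq : ∀ n : ℕ, q ^ (n + 1) ≠ 1) (n : ℕ) : qPoch q q n ≠ 0 :=
  qPoch_ne_zero (fun k => pow_succ' q k ▸ hq k) n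

theorem qPochInf_ne_zero (ha : ∀ n : ℕ, a * q ^ n ≠ 1) (hq : ‖q‖ < 1) : qPochInf a q ≠ 0 := by
  have hsum : Summable fun n : ℕ => ‖-(a * q ^ n)‖ := by
    simp only [norm_neg, norm_mul, norm_pow]
    exact (summable_geometric_of_lt_one (norm_nonneg q) hq).mul_left _
  simpa only [qPochInf, sub_eq_add_neg] using tprod_one_add_ne_zero_of_summable
    (fun n => by simpa only [← sub_eq_add_neg] using sub_ne_zero.mpr (ha n).symm) hsum

end QPochhammer

section QBinomial

variable {a q : ℂ}

/-- The `q`-binomial series `∑_s (a;q)_s / (q;q)_s zˢ`, truncated after the term `s = m`. -/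
noncomputable def qBinomialSum (a q z : ℂ) (m : ℕ) : ℂ :=
  ∑ s ∈ Finset.range (m + 1), qPoch a q s / qPoch q q s * z ^ s

theorem qBinomialSum_zero (a q z : ℂ) : qBinomialSum a q z 0 = 1 := by
  simp [qBinomialSum, qPoch_zero]

theorem qBinomialSum_succ (a q z : ℂ) (m : ℕ) :
    qBinomialSum a q z (m + 1) =
      qBinomialSum a q z m + qPoch a q (m + 1) / qPoch q q (m + 1) * z ^ (m + 1) :=
  Finset.sum_range_succ _ _

theorem qPoch_div_qPoch_succ (a : ℂ) {n : ℕ} (hq : q ^ (n + 1) ≠ 1) :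
    qPoch a q (n + 1) / qPoch q q (n + 1) * (1 - q ^ (n + 1)) =
      qPoch a q n / qPoch q q n * (1 - a * q ^ n) := by
  rw [qPoch_succ a, qPoch_self_succ, mul_div_mul_comm, mul_assoc,
    div_mul_cancel₀ _ (sub_ne_zero.mpr hq.symm)]

theorem one_sub_mul_qBinomialSum (hq : ∀ n : ℕ, q ^ (n + 1) ≠ 1) (a z : ℂ) (m : ℕ) :
    (1 - z) * qBinomialSum a q z m =
      (1 - a * z) * qBinomialSum a q (q * z) m -
        qPoch a q m / qPoch q q m * (1 - a * q ^ m) * z ^ (m + 1) := by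
  induction m with
  | zero =>
    simp only [qBinomialSum_zero, qPoch_zero]
    ring
  | succ m ih =>
    rw [qBinomialSum_succ, qBinomialSum_succ, mul_pow]
    linear_combination ih + z ^ (m + 1) * qPoch_div_qPoch_succ a (hq m)

theorem one_sub_pow_mul_qBinomialSum_succ (hq : ∀ n : ℕ, q ^ (n + 1) ≠ 1) {z : ℂ} {m : ℕ}
    (hz : a * z = q ^ (m + 1)) :
    (1 - q ^ (m + 1)) * qBinomialSum a q (q * z) (m + 1) =
      (1 - z) * qBinomialSum a q z m +
        (1 + q ^ (m + 1)) * (qPoch a q m / qPoch q q m * (1 - a * q ^ m)) * z ^ (m + 1) := by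
  rw [one_sub_mul_qBinomialSum hq, hz, qBinomialSum_succ, ← qPoch_div_qPoch_succ a (hq m), mul_pow]
  ring

theorem tendsto_qBinomialSum {ι : Type*} {l : Filter ι} (a : ℂ) (hq : ‖q‖ < 1) {z : ι → ℂ}
    (hz : Tendsto z l (𝓝 0)) (N : ι → ℕ) :
    Tendsto (fun i => qBinomialSum a q (z i) (N i)) l (𝓝 1) := by
  have hcoeff : Tendsto (fun s => qPoch a q s / qPoch q q s) atTop
      (𝓝 (qPochInf a q / qPochInf q q)) :=
    (qPoch_tendsto_qPochInf a q hq).div (qPoch_tendsto_qPochInf q q hq)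
      (qPochInf_ne_zero (mul_pow_ne_one hq hq.le) hq)
  obtain ⟨C, hC⟩ := (Metric.isBounded_range_of_tendsto _ hcoeff).exists_norm_le
  simpa [qPoch_zero, qBinomialSum] using
    tendsto_sum_range_succ_mul_pow (fun s => hC _ ⟨s, rfl⟩) hz N

end QBinomial

section Gauss

variable {q : ℂ}

/-- The sum `∑_{k=0}^n (-1)ᵏ q^(k²)`. As this covers only `k ≥ 0`, it is
`2 * partialThetaSum q n - 1` that tends to the theta function `∑_{k ∈ ℤ} (-1)ᵏ q^(k²)`. -/
def partialThetaSum (q : ℂ) (n : ℕ) : ℂ := ∑ k ∈ Finset.range (n + 1), (-1) ^ k * q ^ k ^ 2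

theorem partialThetaSum_zero (q : ℂ) : partialThetaSum q 0 = 1 := by simp [partialThetaSum]

theorem partialThetaSum_succ (q : ℂ) (n : ℕ) :
    partialThetaSum q (n + 1) = partialThetaSum q n + (-1) ^ (n + 1) * q ^ (n + 1) ^ 2 :=
  Finset.sum_range_succ _ _

theorem qPoch_neg_one_succ (q : ℂ) (n : ℕ) : qPoch (-1) q (n + 1) = 2 * qPoch (-q) q n := by
  rw [qPoch_succ', neg_one_mul, sub_neg_eq_add, one_add_one_eq_two]

theorem qPoch_mul_two_mul_partialThetaSum_sub_one (hq : ∀ n : ℕ, q ^ (n + 1) ≠ 1) (n : ℕ) :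
    qPoch (-q) q n * (2 * partialThetaSum q n - 1) =
      qPoch q q n * qBinomialSum (-1) q (-q ^ (n + 1)) n := by
  induction n with
  | zero => norm_num [partialThetaSum_zero, qBinomialSum_zero, qPoch_zero]
  | succ n ih =>
    set z := -q ^ (n + 1) with hz
    set d := qPoch (-1) q n / qPoch q q n * (1 - -1 * q ^ n) with hd
    have hd_mul : qPoch q q n * d = 2 * qPoch (-q) q n := by
      rw [hd, ← mul_assoc, mul_div_cancel₀ _ (qPoch_self_ne_zero hq n), ← qPoch_succ,
        qPoch_neg_one_succ]
    have hz_pow : z ^ (n + 1) = (-1) ^ (n + 1) * q ^ (n + 1) ^ 2 := by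
      rw [hz, neg_pow, ← pow_mul, sq]
    have hPoch : qPoch (-q) q (n + 1) = qPoch (-q) q n * (1 + q ^ (n + 1)) := by
      rw [qPoch_succ, pow_succ', neg_mul, sub_neg_eq_add]
    calc qPoch (-q) q (n + 1) * (2 * partialThetaSum q (n + 1) - 1)
        = (1 + q ^ (n + 1)) * (qPoch (-q) q n * (2 * partialThetaSum q n - 1) +
            2 * qPoch (-q) q n * z ^ (n + 1)) := by
          rw [hPoch, partialThetaSum_succ, ← hz_pow]
          ring
      _ = qPoch q q n * ((1 - z) * qBinomialSum (-1) q z n +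
            (1 + q ^ (n + 1)) * d * z ^ (n + 1)) := by
          rw [ih, ← hd_mul, hz]
          ring
      _ = qPoch q q (n + 1) * qBinomialSum (-1) q (q * z) (n + 1) := by
          rw [← one_sub_pow_mul_qBinomialSum_succ hq (by rw [hz, neg_one_mul, neg_neg]),
            qPoch_self_succ, mul_assoc]
      _ = qPoch q q (n + 1) * qBinomialSum (-1) q (-q ^ (n + 2)) (n + 1) := by
          rw [hz, mul_neg, ← pow_succ']

theorem tendsto_two_mul_partialThetaSum_sub_one (hq : ‖q‖ < 1) :
    Tendsto (fun n => 2 * partialThetaSum q n - 1) atTop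
      (𝓝 (qPochInf q q / qPochInf (-q) q)) := by
  have harg : Tendsto (fun n : ℕ => -q ^ (n + 1)) atTop (𝓝 0) := by
    simpa using
      ((tendsto_add_atTop_iff_nat 1).mpr (tendsto_pow_atTop_nhds_zero_of_norm_lt_one hq)).neg
  have hneg_ne : ∀ n : ℕ, -q * q ^ n ≠ 1 := mul_pow_ne_one (by rwa [norm_neg]) hq.le
  have hlim := ((qPoch_tendsto_qPochInf q q hq).mul (tendsto_qBinomialSum (-1) hq harg id)).div
    (qPoch_tendsto_qPochInf (-q) q hq) (qPochInf_ne_zero hneg_ne hq)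
  rw [mul_one] at hlim
  refine hlim.congr fun n => ?_
  rw [Pi.div_apply, id, ← qPoch_mul_two_mul_partialThetaSum_sub_one (pow_succ_ne_one hq),
    mul_div_cancel_left₀ _ (qPoch_ne_zero hneg_ne n)]

theorem tendsto_partialThetaSum (hq : ‖q‖ < 1) :
    Tendsto (partialThetaSum q) atTop
      (𝓝 ((1 + qPochInf q q / qPochInf (-q) q) / 2)) :=
  (((tendsto_two_mul_partialThetaSum_sub_one hq).const_add 1).div_const 2).congr fun n => by ring

end Gauss

section OddPower

variable {q : ℂ}

theorem oddPowerCF_eq_eulerCF (q : ℂ) : oddPowerCF q = eulerCF fun n => q ^ (2 * n + 1) := rfl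

theorem eulerSum_odd_pow (q : ℂ) (n : ℕ) :
    eulerSum (fun j => q ^ (2 * j + 1)) n = partialThetaSum q n := by
  have hprod (k : ℕ) : ∏ j ∈ Finset.range k, -q ^ (2 * j + 1) = (-1) ^ k * q ^ k ^ 2 := by
    induction k with
    | zero => simp
    | succ k ih =>
      rw [Finset.prod_range_succ, ih]
      ring
  exact Finset.sum_congr rfl fun k _ => hprod k

theorem eventually_partialThetaSum_ne_zero (hq : ‖q‖ < 1) :
    ∀ᶠ n in atTop, partialThetaSum q n ≠ 0 := by
  rcases eq_or_ne q 0 with rfl | hq₀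
  · have hone (n : ℕ) : partialThetaSum 0 n = 1 := by
      simp [partialThetaSum, Finset.sum_range_succ']
    simp [hone]
  have hodd : Tendsto (fun n : ℕ => q ^ (2 * n + 1)) atTop (𝓝 0) :=
    (tendsto_pow_atTop_nhds_zero_of_norm_lt_one hq).comp
      (tendsto_atTop_mono (fun n => (by lia : n ≤ 2 * n + 1)) tendsto_id)
  have hsum := (tendsto_partialThetaSum hq).congr fun n => (eulerSum_odd_pow q n).symm
  simpa only [eulerSum_odd_pow] using
    eventually_eulerSum_ne (fun n => pow_ne_zero _ hq₀) hodd hsum 0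

end OddPower

/-- For `|q| < 1` the convergents `Aₙ / Bₙ` of the continued fraction are defined from some
index on, and they converge, in the extended complex plane, to
`(Φ(-q) - f(-q)) / (Φ(-q) + f(-q))`; the value is `∞` where the denominator vanishes. -/
theorem proposition2 (q : ℂ) (hq : ‖q‖ < 1) :
    (∀ᶠ n in atTop, (oddPowerCF q).dens n ≠ 0) ∧
    (ramanujanPhi (-q) + ramanujanF (-q) ≠ 0 →
      Tendsto (fun n : ℕ => (oddPowerCF q).convs n) atTop
        (𝓝 ((ramanujanPhi (-q) - ramanujanF (-q)) / (ramanujanPhi (-q) + ramanujanF (-q))))) ∧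
    (ramanujanPhi (-q) + ramanujanF (-q) = 0 →
      Tendsto (fun n : ℕ => (oddPowerCF q).convs n) atTop (Bornology.cobounded ℂ)) := by
  have hΦ : qPochInf (-q) q ≠ 0 :=
    qPochInf_ne_zero (mul_pow_ne_one (by rwa [norm_neg]) hq.le) hq
  have hsum : eulerSum (fun n => q ^ (2 * n + 1)) = partialThetaSum q := funext (eulerSum_odd_pow q)
  have hlim := tendsto_partialThetaSum hq
  have hne := eventually_partialThetaSum_ne_zero hq
  rw [one_add_div hΦ, div_div] at hlim
  rw [← hsum] at hlim hne
  simp only [oddPowerCF_eq_eulerCF, eulerCF_dens, ramanujanPhi_neg, ramanujanF_neg]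
  refine ⟨hne, fun h => ?_, fun h => ?_⟩
  · convert tendsto_eulerCF_convs (div_ne_zero h (mul_ne_zero hΦ two_ne_zero)) hlim using 2
    field_simp
    ring
  · rw [h, zero_div] at hlim
    exact tendsto_eulerCF_convs_cobounded hne hlim
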